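/- For every $n \in \mathbb{N}$ let $\mathbf{v}^{(n)} = (v^{(n)}_1,\dots,v^{(n)}_n)$ and $\mathbf{x}^{(n)} = (x^{(n)}_1,\dots,x^{(n)}_n)$ be random vectors in $\mathbb{R}^n$, defined on a common probability space (which may depend on $n$). Assume that, for every $n$, the entries $v^{(n)}_1,\dots,v^{(n)}_n$ are independent and each uniformly distributed on $(0,1)$, the entries $x^{(n)}_1,\dots,x^{(n)}_n$ are independent and each standard normal $\mathcal{N}(0,1)$, and the vectors $\mathbf{v}^{(n)}$ and $\mathbf{x}^{(n)}$ are independent of each other. Then $$\frac{1}{\sqrt{n}}\,\mathbf{v}^{(n)}\cdot\mathbf{x}^{(n)} = \frac{1}{\sqrt{n}}\sum_{i=1}^n v^{(n)}_i x^{(n)}_i$$ converges in distribution, as $n \to \infty$, to the normal distribution $\mathcal{N}\left(0,\tfrac13\right)$ with mean $0$ and variance $\tfrac13$. -/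

import Mathlib

open MeasureTheory ProbabilityTheory Filter

/-! The products `v n ω i * x n ω i` in row `n` are i.i.d., centered, with variance E[v²]E[x²] =
1/3, so this is a central limit theorem. The space varies with `n`, so there is no single i.i.d.
sequence; but the characteristic function of a normalized row sum depends only on the common law: it
is φ(t/√n)^n. Its limit and Lévy's continuity theorem conclude. Independence of the products comes
from `iIndepFun_prodMk_of_indepFun`. -/

/-- If two finite families of independent random variables are independent of each other, then the
pairs formed from their corresponding members are independent. -/
lemma iIndepFun_prodMk_of_indepFun {Ω ι α β : Type*} [Fintype ι] [MeasurableSpace Ω]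
    [MeasurableSpace α] [MeasurableSpace β] {μ : Measure Ω} [IsProbabilityMeasure μ]
    {X : ι → Ω → α} {Y : ι → Ω → β}
    (mX : ∀ i, AEMeasurable (X i) μ) (mY : ∀ i, AEMeasurable (Y i) μ)
    (hX : iIndepFun X μ) (hY : iIndepFun Y μ)
    (hXY : IndepFun (fun ω i ↦ X i ω) (fun ω i ↦ Y i ω) μ) :
    iIndepFun (fun i ω ↦ (X i ω, Y i ω)) μ := by
  have mX' : AEMeasurable (fun ω i ↦ X i ω) μ := aemeasurable_pi_lambda _ mX
  have mY' : AEMeasurable (fun ω i ↦ Y i ω) μ := aemeasurable_pi_lambda _ mY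
  have (i : ι) : IsProbabilityMeasure (μ.map (X i)) := Measure.isProbabilityMeasure_map (mX i)
  have (i : ι) : IsProbabilityMeasure (μ.map (Y i)) := Measure.isProbabilityMeasure_map (mY i)
  have hpair (i : ι) :
      μ.map (fun ω ↦ (X i ω, Y i ω)) = (μ.map (X i)).prod (μ.map (Y i)) :=
    (indepFun_iff_map_prod_eq_prod_map_map (mX i) (mY i)).1
      (hXY.comp (measurable_pi_apply i) (measurable_pi_apply i))
  rw [iIndepFun_iff_map_fun_eq_pi_map fun i ↦ (mX i).prodMk (mY i)]
  simp_rw [hpair]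
  -- Regrouping coordinates by `e` turns the product of the pair laws into the product of the two
  -- joint laws, where `hXY` applies.
  let e := MeasurableEquiv.arrowProdEquivProdArrow α β ι
  have he := measurePreserving_arrowProdEquivProdArrow α β ι
    (fun i ↦ μ.map (X i)) (fun i ↦ μ.map (Y i))
  refine e.map_measurableEquiv_injective ?_
  rw [he.map_eq, ← hX.map_fun_eq_pi_map mX, ← hY.map_fun_eq_pi_map mY,
    ← (indepFun_iff_map_prod_eq_prod_map_map mX' mY').1 hXY,
    AEMeasurable.map_map_of_aemeasurable e.measurable.aemeasurable
      (aemeasurable_pi_lambda _ fun i ↦ (mX i).prodMk (mY i))]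
  rfl

/-- A central limit theorem for row sums of a triangular array whose rows consist of independent
random variables, all entries having the same centered law `μ` with variance `w`. The probability
space may change with the row. -/
lemma tendstoInDistribution_inv_sqrt_mul_sum_of_rows
    {Ω : ℕ → Type*} [∀ n, MeasurableSpace (Ω n)]
    {P : ∀ n, Measure (Ω n)} [∀ n, IsProbabilityMeasure (P n)]
    {Y : ∀ n, Fin n → Ω n → ℝ} {μ : Measure ℝ} [IsProbabilityMeasure μ] {w : NNReal} (hw : w ≠ 0)
    (h_mean : ∫ y, y ∂μ = 0) (h_var : ∫ y, y ^ 2 ∂μ = w)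
    (h_law : ∀ n i, HasLaw (Y n i) μ (P n)) (h_indep : ∀ n, iIndepFun (Y n) (P n))
    {Ω' : Type*} [MeasurableSpace Ω'] {P' : Measure Ω'} [IsProbabilityMeasure P']
    {Z : Ω' → ℝ} (hZ : HasLaw Z (gaussianReal 0 w) P') :
    TendstoInDistribution (fun (n : ℕ) ω ↦ (√(n : ℝ))⁻¹ * ∑ i, Y n i ω) atTop Z P P' where
  forall_aemeasurable n :=
    .const_mul (Finset.aemeasurable_fun_sum _ fun i _ ↦ (h_law n i).aemeasurable) _
  aemeasurable_limit := hZ.aemeasurable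
  tendsto := by
    refine ProbabilityMeasure.tendsto_iff_tendsto_charFun.2 fun t ↦ ?_
    -- The limit of φ(t/√n)^n used below needs unit variance: entries are scaled by `σ⁻¹`, and `t`
    -- becomes `σ * t` to compensate.
    obtain ⟨σ, hσ, hσw⟩ : ∃ σ : ℝ, 0 < σ ∧ (w : ℝ) = σ ^ 2 :=
      ⟨√w, Real.sqrt_pos.2 (NNReal.coe_pos.2 (pos_iff_ne_zero.2 hw)),
        (Real.sq_sqrt w.coe_nonneg).symm⟩
    have hchar (n : ℕ) : charFun ((P n).map fun ω ↦ (√(n : ℝ))⁻¹ * ∑ i, Y n i ω) t =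
        charFun (μ.map fun y ↦ σ⁻¹ * y) ((√(n : ℝ))⁻¹ * (σ * t)) ^ n := by
      rw [charFun_map_mul_comp, (h_indep n).charFun_map_fun_sum_eq_prod
        fun i ↦ (h_law n i).aemeasurable, charFun_map_mul]
      · simp only [Finset.prod_apply, (h_law n _).map_eq, Finset.prod_const, Finset.card_univ,
          Fintype.card_fin]
        congr 2
        field_simp
      · exact Finset.aemeasurable_fun_sum _ fun i _ ↦ (h_law n i).aemeasurable
    have hlim := tendsto_charFun_inv_sqrt_mul_pow (P := μ) (X := fun y ↦ σ⁻¹ * y) (by fun_prop)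
      (by rw [integral_const_mul, h_mean, mul_zero])
      (by
        simp only [Pi.pow_apply, mul_pow]
        rw [integral_const_mul, h_var, hσw, ← mul_pow, inv_mul_cancel₀ hσ.ne', one_pow]) (σ * t)
    have hZchar : charFun (P'.map Z) t = Complex.exp (-((σ * t : ℝ) : ℂ) ^ 2 / 2) := by
      have hσw' : ((w : ℝ) : ℂ) = (σ : ℂ) ^ 2 := by exact_mod_cast hσw
      rw [hZ.map_eq, charFun_gaussianReal, hσw']
      push_cast
      congr 1
      ring
    simpa only [ProbabilityMeasure.coe_mk, hchar, hZchar] using hlim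

lemma integral_sq_gaussianReal_zero (v : NNReal) : ∫ x, x ^ 2 ∂(gaussianReal 0 v) = v := by
  have h := variance_fun_id_gaussianReal (μ := 0) (v := v)
  rw [variance_eq_integral measurable_id'.aemeasurable] at h
  simpa [integral_id_gaussianReal] using h

lemma integral_sq_cond_Ioo_zero_one :
    ∫ u, u ^ 2 ∂(ProbabilityTheory.cond (volume : Measure ℝ) (Set.Ioo 0 1)) = 1 / 3 := by
  have h : ∫ u in Set.Ioo (0 : ℝ) 1, u ^ 2 = 1 / 3 := by
    rw [← integral_Ioc_eq_integral_Ioo, ← intervalIntegral.integral_of_le zero_le_one,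
      integral_pow]
    norm_num
  simpa [ProbabilityTheory.cond] using h

theorem lemma1
    {Ω : ℕ → Type*} [∀ n, MeasurableSpace (Ω n)]
    (P : ∀ n, Measure (Ω n)) [∀ n, IsProbabilityMeasure (P n)]
    (v x : ∀ n, Ω n → (Fin n → ℝ))
    (hv_law : ∀ n (i : Fin n), pdf.IsUniform (fun ω => v n ω i) (Set.Ioo (0 : ℝ) 1) (P n))
    (hv_indep : ∀ n, iIndepFun (fun (i : Fin n) ω => v n ω i) (P n))
    (hx_law : ∀ n (i : Fin n), HasLaw (fun ω => x n ω i) (gaussianReal 0 1) (P n))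
    (hx_indep : ∀ n, iIndepFun (fun (i : Fin n) ω => x n ω i) (P n))
    (hvx_indep : ∀ n, IndepFun (v n) (x n) (P n))
    {Ω' : Type*} [MeasurableSpace Ω'] (P' : Measure Ω') [IsProbabilityMeasure P']
    (Z : Ω' → ℝ) (hZ : HasLaw Z (gaussianReal 0 (1 / 3)) P') :
    TendstoInDistribution
      (fun (n : ℕ) ω => 1 / Real.sqrt (n : ℝ) * (v n ω ⬝ᵥ x n ω)) atTop Z P P' := by
  let U : Measure ℝ := ProbabilityTheory.cond volume (Set.Ioo (0 : ℝ) 1)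
  let G : Measure ℝ := gaussianReal 0 1
  have hU : IsProbabilityMeasure U := cond_isProbabilityMeasure_of_finite (by simp) (by simp)
  have mv (n : ℕ) (i : Fin n) : AEMeasurable (fun ω ↦ v n ω i) (P n) :=
    (hv_law n i).aemeasurable (by simp) (by simp)
  have mx (n : ℕ) (i : Fin n) : AEMeasurable (fun ω ↦ x n ω i) (P n) := (hx_law n i).aemeasurable
  have mmul : Measurable fun p : ℝ × ℝ ↦ p.1 * p.2 := by fun_prop
  -- As a pushforward of a product measure, `μ` has moments that factor by Fubini.
  let μ : Measure ℝ := (U.prod G).map fun p ↦ p.1 * p.2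
  have hμ : IsProbabilityMeasure μ := Measure.isProbabilityMeasure_map mmul.aemeasurable
  have h_mean : ∫ y, y ∂μ = 0 := by
    rw [integral_map mmul.aemeasurable (by fun_prop)]
    refine (integral_prod_mul (fun u : ℝ ↦ u) fun g : ℝ ↦ g).trans ?_
    rw [integral_id_gaussianReal, mul_zero]
  have h_var : ∫ y, y ^ 2 ∂μ = ((1 / 3 : NNReal) : ℝ) := by
    rw [integral_map mmul.aemeasurable (by fun_prop)]
    simp_rw [mul_pow]
    refine (integral_prod_mul (fun u : ℝ ↦ u ^ 2) fun g : ℝ ↦ g ^ 2).trans ?_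
    rw [integral_sq_gaussianReal_zero, integral_sq_cond_Ioo_zero_one, NNReal.coe_one, mul_one]
    simp
  have h_law (n : ℕ) (i : Fin n) : HasLaw (fun ω ↦ v n ω i * x n ω i) μ (P n) := by
    refine ⟨(mv n i).mul (mx n i), ?_⟩
    have h := (indepFun_iff_map_prod_eq_prod_map_map (mv n i) (mx n i)).1
      ((hvx_indep n).comp (measurable_pi_apply i) (measurable_pi_apply i))
    have hvU : (P n).map (fun ω ↦ v n ω i) = U := hv_law n i
    rw [hvU, (hx_law n i).map_eq] at h
    change _ = (U.prod G).map fun p ↦ p.1 * p.2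
    rw [← h, AEMeasurable.map_map_of_aemeasurable mmul.aemeasurable ((mv n i).prodMk (mx n i))]
    rfl
  have h_indep (n : ℕ) : iIndepFun (fun (i : Fin n) ω ↦ v n ω i * x n ω i) (P n) :=
    (iIndepFun_prodMk_of_indepFun (mv n) (mx n) (hv_indep n) (hx_indep n) (hvx_indep n)).comp
      (fun _ p ↦ p.1 * p.2) fun _ ↦ mmul
  have := tendstoInDistribution_inv_sqrt_mul_sum_of_rows (by simp) h_mean h_var h_law h_indep hZ
  simpa only [one_div, dotProduct] using this
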